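/- A dimension function is an increasing (i.e. non-decreasing), right-continuous function $h:[0,\infty)\to[0,\infty)$ with $h(0)=0$ and $h(t)>0$ for $t>0$. For dimension functions, $h_2\prec h_1$ means $\lim_{x\to0^+}h_1(x)/h_2(x)=0$. The Hausdorff measure associated with $h$ is $$\mathcal{H}^h(E)=\lim_{\delta\to0}\inf\Big\{\sum_{i\in\mathbb N}h(|U_i|) : E\subseteq\bigcup_{i\in\mathbb N}U_i,\ 0<|U_i|\le\delta\Big\},$$ where $|U|$ denotes the diameter of $U$. **Corollary.** Let $h$ be a dimension function with $h\prec x$ (that is, $\lim_{x\to0^+}x/h(x)=0$), and let $A\subseteq\mathbb{R}\setminus\{1\}$ be a countable set. Then there exists a compact set $E\subseteq[1,2]$ such that $\mathcal{H}^h(E)>0$ and the set of quotients $$\frac{E}{E}:=\Big\{\frac{y}{x} : x,y\in E\Big\}$$ contains no element of $A$. -/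

import Mathlib

open Set Filter Topology MeasureTheory
open scoped NNReal ENNReal Pointwise

namespace GaugeQuotients

/-- A dimension function: `h : [0, ∞) → [0, ∞)` with `h 0 = 0`, positive on `(0, ∞)`,
increasing (in the wide sense) and right-continuous. -/
structure IsDimensionFunction (h : ℝ≥0 → ℝ≥0) : Prop where
  map_zero : h 0 = 0
  pos : ∀ t, 0 < t → 0 < h t
  mono : Monotone h
  rightCts : ∀ t, ContinuousWithinAt h (Ici t) t

/-- The order `h₂ ≺ h₁` on dimension functions: `h₁ x / h₂ x → 0` as `x → 0⁺`. -/
def Prec (h₂ h₁ : ℝ≥0 → ℝ≥0) : Prop :=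
  Tendsto (fun x => h₁ x / h₂ x) (𝓝[>] 0) (𝓝 0)

/-- The Hausdorff measure `𝓗^h` on `ℝ` of a dimension function `h`, as an instance of the
general (Caratheodory) construction of Mathlib. Only coverings by sets of small diameter matter,
so the value given here to an infinite diameter is irrelevant. The lemma
`hausdorffGauge_eq` below identifies it with the usual formula. -/
noncomputable def hausdorffGauge (h : ℝ≥0 → ℝ≥0) : Measure ℝ :=
  Measure.mkMetric fun r : ℝ≥0∞ => (h r.toNNReal : ℝ≥0∞)

/-- `U` is a `δ`-covering of `E`: a countable covering by sets of diameter in `(0, δ]`. -/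
def IsDeltaCovering (δ : ℝ≥0) (U : ℕ → Set ℝ) (E : Set ℝ) : Prop :=
  E ⊆ ⋃ i, U i ∧ ∀ i, 0 < Metric.ediam (U i) ∧ Metric.ediam (U i) ≤ δ

/-- `𝓗^h E` is the supremum over `δ > 0` (that is, the limit as `δ → 0`) of the infimum of
`∑ h (|U i|)` over the `δ`-coverings `U` of `E`. -/
theorem hausdorffGauge_eq {h : ℝ≥0 → ℝ≥0} (hh : IsDimensionFunction h) (E : Set ℝ) :
    hausdorffGauge h E =
      ⨆ (δ : ℝ≥0) (_ : 0 < δ), ⨅ (U : ℕ → Set ℝ) (_ : IsDeltaCovering δ U E),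
        ∑' i, (h (Metric.ediam (U i)).toNNReal : ℝ≥0∞) := by
  rw [hausdorffGauge, Measure.mkMetric_apply]
  apply le_antisymm
  · refine iSup₂_le fun r hr => ?_
    obtain ⟨δ, hδ0, hδr⟩ := ENNReal.lt_iff_exists_nnreal_btwn.1 hr
    refine le_iSup₂_of_le δ (by exact_mod_cast hδ0) ?_
    refine le_iInf₂ fun U hU => ?_
    refine iInf₂_le_of_le U hU.1 (iInf_le_of_le (fun i => (hU.2 i).2.trans hδr.le) ?_)
    exact ENNReal.tsum_le_tsum fun i => iSup_le fun _ => le_rfl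
  · refine iSup₂_le fun δ hδ => ?_
    refine le_iSup₂_of_le (δ : ℝ≥0∞) (by exact_mod_cast hδ) ?_
    refine le_iInf₂ fun t ht => le_iInf fun htδ => ?_
    refine ENNReal.le_of_forall_pos_le_add fun ε hε _ => ?_
    obtain ⟨e, he0, hes⟩ := ENNReal.exists_pos_sum_of_countable
      (ε := (ε : ℝ≥0∞)) (by exact_mod_cast hε.ne') ℕ
    have key : ∀ i, ∃ V : Set ℝ, t i ⊆ V ∧ 0 < Metric.ediam V ∧ Metric.ediam V ≤ δ ∧
        (h (Metric.ediam V).toNNReal : ℝ≥0∞) ≤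
          (⨆ _ : (t i).Nonempty, (h (Metric.ediam (t i)).toNNReal : ℝ≥0∞)) + e i := by
      intro i
      by_cases h0 : Metric.ediam (t i) = 0
      · have hc := hh.rightCts 0
        have hev : ∀ᶠ x in 𝓝[>] (0 : ℝ≥0), h x < e i ∧ x ≤ δ := by
          have h1 : Tendsto h (𝓝[>] 0) (𝓝 0) := by
            have := hc.mono Ioi_subset_Ici_self
            rwa [ContinuousWithinAt, hh.map_zero] at this
          exact (h1.eventually (gt_mem_nhds (he0 i))).and
            (mem_nhdsWithin_of_mem_nhds (Iic_mem_nhds hδ))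
        obtain ⟨η, ⟨hη1, hη2⟩, hη3⟩ := (hev.and self_mem_nhdsWithin).exists
        have hsub : (t i).Subsingleton := Metric.ediam_eq_zero_iff.1 h0
        obtain ⟨x, hx⟩ : ∃ x : ℝ, t i ⊆ {x} := by
          rcases hsub.eq_empty_or_singleton with h | ⟨x, h⟩
          · exact ⟨0, by simp [h]⟩
          · exact ⟨x, h.subset⟩
        have hd : Metric.ediam (Icc x (x + η)) = (η : ℝ≥0∞) := by
          rw [Real.ediam_Icc]; simp
        refine ⟨Icc x (x + η), hx.trans (by simp), ?_, ?_, ?_⟩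
        · rw [hd]; exact_mod_cast hη3
        · rw [hd]; exact_mod_cast hη2
        · rw [hd, ENNReal.toNNReal_coe]
          exact le_add_left (by exact_mod_cast hη1.le)
      · refine ⟨t i, Subset.rfl, pos_iff_ne_zero.2 h0, htδ i, ?_⟩
        have hne : (t i).Nonempty := by
          rw [nonempty_iff_ne_empty]; rintro h; simp [h] at h0
        exact le_add_right (le_iSup_of_le hne le_rfl)
    choose V hV1 hV2 hV3 hV4 using key
    refine iInf₂_le_of_le V ⟨ht.trans (iUnion_mono hV1), fun i => ⟨hV2 i, hV3 i⟩⟩ ?_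
    refine (ENNReal.tsum_le_tsum hV4).trans ?_
    rw [ENNReal.tsum_add]
    gcongr

end GaugeQuotients

/-!
Write `x ∈ [1, 2]` in the coordinate `log x`. If `l * log a` is an odd multiple of `π`, then
`sin (l * log (a * x)) = - sin (l * log x)`, so no two points of `{x | 1 / 2 ≤ sin (l * log x)}`
have quotient `a`. Here the frequency `l` may be taken as large as desired. For an enumeration
`a₀, a₁, …` of `A`, the set `E` consists of the points of `[1, 2]` with `1 / 2 ≤ sin (l k * log x)`
for all `k`, where `l k` is such a frequency for `a k`. (Elements `a ≤ 0` are never quotients.)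

To see that `E` is large, fix a smooth `2π`-periodic `g ≥ 0` of mean one that vanishes
where `sin t < 1 / 2`, bounded by `M`, and let `ρ n x = ∏ k < n, g (l k * log x)`. Integration by
parts (`exists_bound_integral_oscillation`) shows that multiplying a fixed `C¹` density by
`g (l * log x)` changes its primitive by `O(1 / l)`, so `l n` can be chosen such that the
primitives of `ρ n` and `ρ (n + 1)` are as close as desired. At scales `r` where
`h r ≥ M ^ n * r`, the density bound `ρ n ≤ M ^ n` gives the mass bound `∫_I ρ n ≤ h |I|`, and at
larger scales the mass of `I` changes, in the passage to later `n`, only by a summable multiple of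
`h |I|` (`integral_le_two_mul_gauge`). So `∫_I ρ n ≤ 2 * h |I|` for all `n` and all short `I`, while
the total masses stay above `1 / 2`. A covering of `E` by open sets covers the support of some
`ρ n`, by compactness, and the mass distribution principle then bounds `∑ h |U i|` from below
(`hausdorffGauge_iInter_pos`).
-/

namespace GaugeQuotients

/-! ### An oscillating periodic weight -/

/-- A continuously differentiable, nonnegative, `2π`-periodic function of mean one that vanishes
where `sin` is less than `1 / 2`, together with an upper bound `M`. -/
structure IsWeight (g : ℝ → ℝ) (M : ℝ) : Prop where
  contDiff : ContDiff ℝ 1 g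
  periodic : Function.Periodic g (2 * Real.pi)
  nonneg : ∀ t, 0 ≤ g t
  le : ∀ t, g t ≤ M
  one_le : 1 ≤ M
  integral_eq : ∫ t in (0 : ℝ)..(2 * Real.pi), g t = 2 * Real.pi
  half_le_sin : ∀ t, g t ≠ 0 → 1 / 2 ≤ Real.sin t

theorem exists_isWeight : ∃ g M, IsWeight g M := by
  set f : ℝ → ℝ := fun t => Real.smoothTransition (Real.sin t - 1 / 2) with hf
  have hfc : ContDiff ℝ 1 f :=
    Real.smoothTransition.contDiff.comp (Real.contDiff_sin.sub contDiff_const)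
  have hf0 : ∀ t, 0 ≤ f t := fun t => Real.smoothTransition.nonneg _
  have hf1 : ∀ t, f t ≤ 1 := fun t => Real.smoothTransition.le_one _
  have hpi := Real.pi_pos
  have hI : 0 < ∫ t in (0 : ℝ)..(2 * Real.pi), f t := by
    refine intervalIntegral.integral_pos (by positivity) hfc.continuous.continuousOn
      (fun t _ => hf0 t) ⟨Real.pi / 2, ⟨by positivity, by linarith⟩, ?_⟩
    exact Real.smoothTransition.pos_of_pos (by rw [Real.sin_pi_div_two]; norm_num)
  set I := ∫ t in (0 : ℝ)..(2 * Real.pi), f t with hIdef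
  have hI2 : I ≤ 2 * Real.pi := by
    have := intervalIntegral.integral_mono_on (μ := volume) (a := 0) (b := 2 * Real.pi)
      (by positivity) (hfc.continuous.intervalIntegrable _ _)
      (continuous_const.intervalIntegrable _ _) (fun t _ => hf1 t)
    simpa using this
  refine ⟨fun t => 2 * Real.pi / I * f t, 2 * Real.pi / I, contDiff_const.mul hfc, ?_, ?_, ?_,
    ?_, ?_, ?_⟩
  · intro t
    simp [hf, Real.sin_add_two_pi]
  · intro t
    have := hf0 t
    positivity
  · intro t
    exact mul_le_of_le_one_right (by positivity) (hf1 t)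
  · rwa [one_le_div hI]
  · rw [intervalIntegral.integral_const_mul, ← hIdef]
    field_simp
  · intro t ht
    by_contra! hlt
    have h0 : f t = 0 := Real.smoothTransition.zero_of_nonpos (by linarith)
    exact ht (by simp [h0])

/-- The centred primitive of a weight is periodic and continuous, hence bounded. -/
theorem IsWeight.exists_primitive {g : ℝ → ℝ} {M : ℝ} (hg : IsWeight g M) :
    ∃ (K : ℝ → ℝ) (B : ℝ), (∀ t, HasDerivAt K (g t - 1) t) ∧ ∀ t, |K t| ≤ B := by
  have hc : Continuous fun t => g t - 1 := hg.contDiff.continuous.sub continuous_const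
  set K : ℝ → ℝ := fun t => ∫ s in (0 : ℝ)..t, (g s - 1) with hK
  have hd : ∀ t, HasDerivAt K (g t - 1) t := fun t =>
    intervalIntegral.integral_hasDerivAt_right (hc.intervalIntegrable _ _)
      (hc.stronglyMeasurableAtFilter _ _) hc.continuousAt
  have hp : Function.Periodic K (2 * Real.pi) := by
    intro t
    have hper : Function.Periodic (fun t => g t - 1) (2 * Real.pi) := fun s => by
      simp [hg.periodic s]
    have h0 : ∫ s in (0 : ℝ)..(2 * Real.pi), (g s - 1) = 0 := by
      rw [intervalIntegral.integral_sub (hg.contDiff.continuous.intervalIntegrable _ _)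
        (continuous_const.intervalIntegrable _ _), hg.integral_eq]
      simp
    have h1 := hper.intervalIntegral_add_eq t 0
    rw [zero_add, h0] at h1
    have h2 := intervalIntegral.integral_add_adjacent_intervals
      (hc.intervalIntegrable (μ := volume) 0 t)
      (hc.intervalIntegrable (μ := volume) t (t + 2 * Real.pi))
    simp only [hK]
    rw [← h2, h1, add_zero]
  have hKc : Continuous K := continuous_iff_continuousAt.2 fun t => (hd t).continuousAt
  obtain ⟨B, hB⟩ := (hp.compact_of_continuous (by positivity) hKc).isBounded.exists_norm_le
  exact ⟨K, B, hd, fun t => hB _ ⟨t, rfl⟩⟩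

/-- Riemann–Lebesgue estimate with rate: the primitive of an oscillating `C¹` function is
`O(1 / l)`, uniformly in the upper endpoint. -/
theorem exists_bound_integral_oscillation {g : ℝ → ℝ} {M : ℝ} (hg : IsWeight g M) {f : ℝ → ℝ}
    (hf : ContDiffOn ℝ 1 f (Ioi 0)) :
    ∃ C : ℝ, ∀ l : ℝ, 0 < l → ∀ t ∈ Icc (1 : ℝ) 2,
      |∫ x in (1 : ℝ)..t, f x * (g (l * Real.log x) - 1)| ≤ C / l := by
  obtain ⟨K, B, hK, hB⟩ := hg.exists_primitive
  set u : ℝ → ℝ := fun x => x * f x with hu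
  have huc : ContDiffOn ℝ 1 u (Ioi 0) := contDiffOn_id.mul hf
  have hsub : Icc (1 : ℝ) 2 ⊆ Ioi 0 := fun x hx => lt_of_lt_of_le one_pos hx.1
  have hud : ContinuousOn (deriv u) (Ioi 0) :=
    huc.continuousOn_deriv_of_isOpen isOpen_Ioi le_rfl
  obtain ⟨C₀, hC₀⟩ := isCompact_Icc.exists_bound_of_continuousOn (huc.continuousOn.mono hsub)
  obtain ⟨C₁, hC₁⟩ := isCompact_Icc.exists_bound_of_continuousOn (hud.mono hsub)
  have hB0 : 0 ≤ B := (abs_nonneg _).trans (hB 0)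
  refine ⟨B * (2 * C₀ + C₁), fun l hl t ht => ?_⟩
  have hC₁0 : 0 ≤ C₁ := (norm_nonneg _).trans (hC₁ t ht)
  have hIt : uIcc 1 t ⊆ Icc (1 : ℝ) 2 := by
    rw [uIcc_of_le ht.1]; exact Icc_subset_Icc le_rfl ht.2
  have hpos : ∀ x ∈ uIcc 1 t, 0 < x := fun x hx => hsub (hIt hx)
  set v : ℝ → ℝ := fun x => K (l * Real.log x) / l with hv
  have hvB : ∀ x, |v x| ≤ B / l := fun x => by
    simp only [hv]
    rw [abs_div, abs_of_pos hl]
    gcongr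
    exact hB _
  have hderiv : ∀ x ∈ uIcc 1 t, HasDerivAt v ((g (l * Real.log x) - 1) / x) x := by
    intro x hx
    have hx0 := hpos x hx
    have h1 : HasDerivAt (fun x => l * Real.log x) (l * x⁻¹) x :=
      (Real.hasDerivAt_log hx0.ne').const_mul l
    have h2 := ((hK (l * Real.log x)).comp x h1).div_const l
    refine h2.congr_deriv ?_
    field_simp
  have hlogc : ContinuousOn (fun x => l * Real.log x) (uIcc 1 t) :=
    continuousOn_const.mul (Real.continuousOn_log.mono fun x hx => (hpos x hx).ne')
  have hvc : ContinuousOn (fun x => (g (l * Real.log x) - 1) / x) (uIcc 1 t) :=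
    ((hg.contDiff.continuous.comp_continuousOn hlogc).sub continuousOn_const).div continuousOn_id
      fun x hx => (hpos x hx).ne'
  have hparts := intervalIntegral.integral_mul_deriv_eq_deriv_mul (u := u) (v := v)
    (fun x hx => ((huc.differentiableOn one_ne_zero).differentiableAt
      (Ioi_mem_nhds (hpos x hx))).hasDerivAt) hderiv
    ((hud.mono (hIt.trans hsub)).intervalIntegrable) hvc.intervalIntegrable
  have hcongr : ∫ x in (1 : ℝ)..t, f x * (g (l * Real.log x) - 1) =
      ∫ x in (1 : ℝ)..t, u x * ((g (l * Real.log x) - 1) / x) := by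
    refine intervalIntegral.integral_congr fun x hx => ?_
    have h0 := (hpos x hx).ne'
    change f x * (g (l * Real.log x) - 1) = x * f x * ((g (l * Real.log x) - 1) / x)
    rw [mul_comm x, mul_assoc, mul_div_cancel₀ _ h0]
  have hint : |∫ x in (1 : ℝ)..t, deriv u x * v x| ≤ C₁ * (B / l) := by
    have h1 := intervalIntegral.norm_integral_le_of_norm_le_const (a := 1) (b := t)
      (f := fun x => deriv u x * v x) (C := C₁ * (B / l)) fun x hx => by
        rw [norm_mul]
        exact mul_le_mul (hC₁ x (hIt (uIoc_subset_uIcc hx))) (hvB x) (norm_nonneg _) hC₁0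
    have h2 : |t - 1| ≤ 1 := by rw [abs_le]; constructor <;> linarith [ht.1, ht.2]
    exact h1.trans (mul_le_of_le_one_right (by positivity) h2)
  have hend : ∀ x ∈ Icc (1 : ℝ) 2, |u x * v x| ≤ C₀ * (B / l) := fun x hx => by
    rw [abs_mul]
    exact mul_le_mul (hC₀ x hx) (hvB x) (abs_nonneg _) ((norm_nonneg _).trans (hC₀ x hx))
  rw [hcongr, hparts]
  have e1 := hend t ht
  have e2 := hend 1 ⟨le_rfl, one_le_two⟩
  calc _ ≤ |u t * v t| + |u 1 * v 1| + |∫ x in (1 : ℝ)..t, deriv u x * v x| :=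
        (abs_sub _ _).trans (add_le_add (abs_sub _ _) le_rfl)
    _ ≤ C₀ * (B / l) + C₀ * (B / l) + C₁ * (B / l) := by gcongr
    _ = B * (2 * C₀ + C₁) / l := by ring

/-- For suitable, arbitrarily large `l`, two positive numbers of quotient `a` cannot both satisfy
`1 / 2 ≤ sin (l * log x)`: for `a > 0` take `l * log a` to be an odd multiple of `π`. -/
theorem exists_frequency {a : ℝ} (ha : a ≠ 1) (L : ℝ) :
    ∃ l, L ≤ l ∧ ∀ x y, 0 < x → 0 < y → y = a * x →
      1 / 2 ≤ Real.sin (l * Real.log x) → Real.sin (l * Real.log y) < 1 / 2 := by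
  by_cases ha0 : 0 < a
  · have hlog : 0 < |Real.log a| := abs_pos.2 (Real.log_ne_zero_of_pos_of_ne_one ha0 ha)
    have hpi := Real.pi_pos
    obtain ⟨m, hm⟩ := exists_nat_ge (L * |Real.log a| / Real.pi)
    refine ⟨Real.pi * (2 * m + 1) / |Real.log a|, ?_, ?_⟩
    · rw [le_div_iff₀ hlog]
      rw [div_le_iff₀ hpi] at hm
      have : (0 : ℝ) ≤ m := m.cast_nonneg
      nlinarith
    · rintro x y hx hy rfl hsx
      set l := Real.pi * (2 * m + 1) / |Real.log a| with hl
      have hla : l * |Real.log a| = Real.pi * (2 * m + 1) := div_mul_cancel₀ _ hlog.ne'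
      have hanti : Real.sin (l * Real.log (a * x)) = -Real.sin (l * Real.log x) := by
        rw [Real.log_mul ha0.ne' hx.ne']
        rcases abs_cases (Real.log a) with ⟨h, -⟩ | ⟨h, -⟩
        · have hodd : l * (Real.log a + Real.log x) =
              (l * Real.log x + Real.pi) + m * (2 * Real.pi) := by
            rw [h] at hla
            rw [mul_add, hla]; ring
          rw [hodd, Real.sin_add_nat_mul_two_pi, Real.sin_add_pi]
        · have hodd : l * (Real.log a + Real.log x) =
              (l * Real.log x - Real.pi) - m * (2 * Real.pi) := by
            rw [h] at hla
            linear_combination -hla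
          rw [hodd, Real.sin_sub_nat_mul_two_pi, Real.sin_sub_pi]
      rw [hanti]; linarith
  · refine ⟨L, le_rfl, fun x y hx hy hxy => ?_⟩
    exact absurd (pos_of_mul_pos_left (hxy ▸ hy) hx.le) ha0

/-! ### The densities -/

/-- `∏ k < n, g (l k * log x)`, the density of the `n`-th approximation to the mass on the
limit set. -/
noncomputable def density (g : ℝ → ℝ) (l : ℕ → ℝ) : ℕ → ℝ → ℝ
  | 0, _ => 1
  | n + 1, x => density g l n x * g (l n * Real.log x)

theorem density_contDiffOn {g : ℝ → ℝ} {M : ℝ} (hg : IsWeight g M) (l : ℕ → ℝ) (n : ℕ) :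
    ContDiffOn ℝ 1 (density g l n) (Ioi 0) := by
  induction n with
  | zero => exact contDiffOn_const
  | succ n ih =>
    refine ih.mul (hg.contDiff.comp_contDiffOn (contDiffOn_const.mul ?_))
    exact Real.contDiffOn_log.mono fun x hx => (ne_of_gt hx : x ≠ 0)

theorem density_nonneg {g : ℝ → ℝ} {M : ℝ} (hg : IsWeight g M) (l : ℕ → ℝ) (n : ℕ) (x : ℝ) :
    0 ≤ density g l n x := by
  induction n with
  | zero => exact zero_le_one
  | succ n ih => exact mul_nonneg ih (hg.nonneg _)

theorem density_le {g : ℝ → ℝ} {M : ℝ} (hg : IsWeight g M) (l : ℕ → ℝ) (n : ℕ) (x : ℝ) :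
    density g l n x ≤ M ^ n := by
  induction n with
  | zero => simp [density]
  | succ n ih =>
    rw [pow_succ]
    exact mul_le_mul ih (hg.le _) (hg.nonneg _) (pow_nonneg (zero_le_one.trans hg.one_le) n)

theorem half_le_sin_of_density_ne_zero {g : ℝ → ℝ} {M : ℝ} (hg : IsWeight g M) (l : ℕ → ℝ)
    (n : ℕ) (x : ℝ) (hx : density g l n x ≠ 0) :
    ∀ k < n, 1 / 2 ≤ Real.sin (l k * Real.log x) := by
  induction n with
  | zero => intro k hk; omega
  | succ n ih =>
    intro k hk
    have h1 := mul_ne_zero_iff.1 hx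
    rcases Nat.lt_succ_iff_lt_or_eq.1 hk with hk | rfl
    · exact ih h1.1 k hk
    · exact hg.half_le_sin _ h1.2

theorem density_intervalIntegrable {g : ℝ → ℝ} {M : ℝ} (hg : IsWeight g M) (l : ℕ → ℝ) (n : ℕ)
    {u v : ℝ} (hu : 0 < u) (hv : 0 < v) :
    IntervalIntegrable (density g l n) volume u v :=
  ((density_contDiffOn hg l n).continuousOn.mono fun _ hx =>
    lt_of_lt_of_le (lt_min hu hv) hx.1).intervalIntegrable

/-- Frequencies can be chosen one after the other, each depending on the density that the
previous ones determine. -/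
theorem exists_seq_density {g : ℝ → ℝ} {M : ℝ} (hg : IsWeight g M)
    (Q : ℕ → (ℝ → ℝ) → ℝ → Prop)
    (hQ : ∀ n f, ContDiffOn ℝ 1 f (Ioi 0) → ∃ l, Q n f l) :
    ∃ l : ℕ → ℝ, ∀ n, Q n (density g l n) (l n) := by
  have hQ' : ∀ n f, ∃ l, ContDiffOn ℝ 1 f (Ioi 0) → Q n f l := fun n f => by
    by_cases hf : ContDiffOn ℝ 1 f (Ioi 0)
    · obtain ⟨l, hl⟩ := hQ n f hf
      exact ⟨l, fun _ => hl⟩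
    · exact ⟨0, fun h => absurd h hf⟩
  choose Λ hΛ using hQ'
  let ρ : ℕ → ℝ → ℝ := fun n =>
    Nat.rec (fun _ => 1) (fun n f x => f x * g (Λ n f * Real.log x)) n
  have hρ : ∀ n, density g (fun n => Λ n (ρ n)) n = ρ n := by
    intro n
    induction n with
    | zero => rfl
    | succ n ih =>
      funext x
      simp only [density, ih, ρ]
  refine ⟨fun n => Λ n (ρ n), fun n => ?_⟩
  have := hΛ n _ (density_contDiffOn hg (fun n => Λ n (ρ n)) n)
  rwa [hρ] at this ⊢

theorem integral_density_succ {g : ℝ → ℝ} {M : ℝ} (hg : IsWeight g M) (l : ℕ → ℝ) (n : ℕ)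
    {t : ℝ} (ht : 0 < t) :
    ∫ x in (1 : ℝ)..t, density g l (n + 1) x = (∫ x in (1 : ℝ)..t, density g l n x) +
      ∫ x in (1 : ℝ)..t, density g l n x * (g (l n * Real.log x) - 1) := by
  have h1 := density_intervalIntegrable hg l (n + 1) one_pos ht
  have h2 := density_intervalIntegrable hg l n one_pos ht
  have h3 : ∀ x, density g l n x * (g (l n * Real.log x) - 1) =
      density g l (n + 1) x - density g l n x := fun x => by
    simp only [density]; ring
  simp only [h3]
  rw [intervalIntegral.integral_sub h1 h2]
  ring

/-- The mass bound. At scales up to `r n` it follows from the bound `M ^ n` on the density;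
at larger scales it is inherited from the previous density, up to an error that is small compared
with the gauge at the scale `r n`. -/
theorem integral_le_two_mul_gauge {g : ℝ → ℝ} {M : ℝ} (hg : IsWeight g M) {l : ℕ → ℝ}
    {h : ℝ≥0 → ℝ≥0} (hh : IsDimensionFunction h) {r : ℕ → ℝ≥0}
    (hr : ∀ n, ∀ t ≤ r n, M ^ n * t ≤ h t)
    (hl : ∀ n, ∀ t ∈ Icc (1 : ℝ) 2,
      |∫ x in (1 : ℝ)..t, density g l n x * (g (l n * Real.log x) - 1)| ≤
        (1 / 2) ^ (n + 2) * h (r (n + 1)))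
    (n : ℕ) {u v : ℝ} (hu : 1 ≤ u) (huv : u ≤ v) (hv : v ≤ 2) (huvr : v - u ≤ r 0) :
    ∫ x in u..v, density g l n x ≤ 2 * h (v - u).toNNReal := by
  set s := (v - u).toNNReal with hs
  have hsv : (s : ℝ) = v - u := Real.coe_toNNReal _ (by linarith)
  have hu0 : 0 < u := one_pos.trans_le hu
  have hv0 : 0 < v := hu0.trans_le huv
  have hsmall : ∀ n, s ≤ r n → ∫ x in u..v, density g l n x ≤ h s := by
    intro n hn
    have h1 := intervalIntegral.integral_mono_on huv (density_intervalIntegrable hg l n hu0 hv0)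
      (continuous_const.intervalIntegrable (μ := volume) u v) fun x _ => density_le hg l n x
    rw [intervalIntegral.integral_const, smul_eq_mul, mul_comm, ← hsv] at h1
    exact h1.trans (hr n s hn)
  suffices H : ∫ x in u..v, density g l n x ≤ (2 - (1 / 2) ^ n) * h s by
    refine H.trans (mul_le_mul_of_nonneg_right ?_ (h s).2)
    linarith [show (0 : ℝ) ≤ (1 / 2) ^ n by positivity]
  induction n with
  | zero =>
    have := hsmall 0 (by rw [← NNReal.coe_le_coe, hsv]; exact huvr)
    norm_num
    exact this
  | succ n ih =>
    have hp : (0 : ℝ) ≤ (1 / 2) ^ (n + 1) := by positivity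
    have hp1 : ((1 : ℝ) / 2) ^ (n + 1) ≤ 1 := pow_le_one₀ (by norm_num) (by norm_num)
    rcases le_total s (r (n + 1)) with hc | hc
    · refine (hsmall (n + 1) hc).trans ?_
      have := (h s).2
      nlinarith
    · have hdiff : ∀ n, ∫ x in u..v, density g l n x =
          (∫ x in (1 : ℝ)..v, density g l n x) - ∫ x in (1 : ℝ)..u, density g l n x := fun n =>
        (intervalIntegral.integral_interval_sub_left
          (density_intervalIntegrable hg l n one_pos hv0)
          (density_intervalIntegrable hg l n one_pos hu0)).symm
      have e1 := (abs_le.1 (hl n v ⟨hu.trans huv, hv⟩)).2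
      have e2 := (abs_le.1 (hl n u ⟨hu, huv.trans hv⟩)).1
      have e3 : (h (r (n + 1)) : ℝ) ≤ h s := hh.mono hc
      have e4 := mul_le_mul_of_nonneg_left e3 hp
      rw [hdiff] at ih ⊢
      rw [integral_density_succ hg l n hv0, integral_density_succ hg l n hu0]
      have e5 : ((1 : ℝ) / 2) ^ (n + 2) = (1 / 2) ^ (n + 1) / 2 := by rw [pow_succ]; ring
      have e6 : ((1 : ℝ) / 2) ^ n = 2 * (1 / 2) ^ (n + 1) := by rw [pow_succ]; ring
      rw [e5] at e1 e2
      rw [e6] at ih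
      linarith

theorem half_le_integral_density {g : ℝ → ℝ} {M : ℝ} (hg : IsWeight g M) {l : ℕ → ℝ}
    (hl : ∀ n, |∫ x in (1 : ℝ)..2, density g l n x * (g (l n * Real.log x) - 1)| ≤
      (1 / 2) ^ (n + 2))
    (n : ℕ) : 1 / 2 ≤ ∫ x in (1 : ℝ)..2, density g l n x := by
  suffices H : 1 / 2 + (1 / 2) ^ (n + 1) ≤ ∫ x in (1 : ℝ)..2, density g l n x by
    linarith [show (0 : ℝ) ≤ (1 / 2) ^ (n + 1) by positivity]
  induction n with
  | zero => simp [density]; norm_num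
  | succ n ih =>
    rw [integral_density_succ hg l n two_pos]
    have e := (abs_le.1 (hl n)).1
    have e5 : ((1 : ℝ) / 2) ^ (n + 1 + 1) = (1 / 2) ^ (n + 1) / 2 := by rw [pow_succ]; ring
    have e6 : ((1 : ℝ) / 2) ^ (n + 2) = (1 / 2) ^ (n + 1) / 2 := by rw [pow_succ]; ring
    rw [e6] at e
    rw [e5]
    linarith

/-! ### Lower bounds for the Hausdorff measure -/

/-- A mass distribution principle for decreasing intersections of compact sets, where each
approximation carries a measure of its own and the bounds are uniform. -/
theorem hausdorffGauge_iInter_pos {h : ℝ≥0 → ℝ≥0} (hh : IsDimensionFunction h)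
    {F : ℕ → Set ℝ} (hFa : Antitone F) (hFc : ∀ n, IsCompact (F n)) {μ : ℕ → Measure ℝ}
    {c : ℝ≥0∞} (hc : c ≠ 0) {C r : ℝ≥0} (hr : 0 < r) (hF : ∀ n, c ≤ μ n (F n))
    (hμ : ∀ n x, ∀ s : ℝ≥0, s ≤ r → μ n (Icc x (x + s)) ≤ C * h s) :
    0 < hausdorffGauge h (⋂ n, F n) := by
  by_contra! hzero
  obtain ⟨ε, hε, hεc⟩ : ∃ ε : ℝ≥0, 0 < ε ∧ (2 * C * (ε + ε) : ℝ≥0∞) < c := by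
    obtain ⟨c', h0, h1⟩ := ENNReal.lt_iff_exists_nnreal_btwn.1 (pos_iff_ne_zero.2 hc)
    have h0' : 0 < c' := by exact_mod_cast h0
    refine ⟨c' / (4 * C + 1), by positivity, lt_of_le_of_lt ?_ h1⟩
    have : 2 * C * (c' / (4 * C + 1) + c' / (4 * C + 1)) ≤ c' := by
      rw [← two_mul, mul_div_assoc', mul_div_assoc', div_le_iff₀ (by positivity)]
      nlinarith [show 0 ≤ c' from h0'.le]
    exact_mod_cast this
  have hr2 : 0 < r / 2 := by positivity
  have hinf : ⨅ (U : ℕ → Set ℝ) (_ : IsDeltaCovering (r / 2) U (⋂ n, F n)),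
      ∑' i, (h (Metric.ediam (U i)).toNNReal : ℝ≥0∞) < ε := by
    rw [hausdorffGauge_eq hh] at hzero
    exact ((le_iSup₂_of_le (r / 2) hr2 le_rfl).trans hzero).trans_lt (by exact_mod_cast hε)
  simp only [iInf_lt_iff] at hinf
  obtain ⟨U, ⟨hUc, hUd⟩, hUs⟩ := hinf
  obtain ⟨e, he0, hes⟩ := ENNReal.exists_pos_sum_of_countable
    (ε := (ε : ℝ≥0∞)) (by exact_mod_cast hε.ne') ℕ
  have hdfin : ∀ i, Metric.ediam (U i) ≠ ∞ := fun i =>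
    ne_top_of_le_ne_top ENNReal.coe_ne_top (hUd i).2
  have hxs : ∀ i, ∃ x ∈ U i, ∃ s : ℝ≥0, Metric.ediam (U i) < s ∧ s ≤ r ∧
      h s ≤ h (Metric.ediam (U i)).toNNReal + e i := by
    intro i
    obtain ⟨x, hx⟩ : (U i).Nonempty := by
      rw [nonempty_iff_ne_empty]
      intro h0
      simpa [h0] using (hUd i).1
    set d := (Metric.ediam (U i)).toNNReal with hd
    have hdU : (d : ℝ≥0∞) = Metric.ediam (U i) := ENNReal.coe_toNNReal (hdfin i)
    have hdr : d < r := by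
      have h1 : d ≤ r / 2 := by
        rw [← ENNReal.coe_le_coe, hdU]; exact (hUd i).2
      exact h1.trans_lt (NNReal.half_lt_self hr.ne')
    have h1 : Tendsto h (𝓝[>] d) (𝓝 (h d)) := (hh.rightCts d).mono Ioi_subset_Ici_self
    have hev : ∀ᶠ s in 𝓝[>] d, h s < h d + e i ∧ s < r :=
      (h1.eventually (gt_mem_nhds (lt_add_of_pos_right _ (he0 i)))).and
        (mem_nhdsWithin_of_mem_nhds (Iio_mem_nhds hdr))
    have : (𝓝[>] d).NeBot := nhdsGT_neBot_of_exists_gt ⟨r, hdr⟩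
    obtain ⟨s, ⟨hs1, hs2⟩, hs3⟩ := (hev.and self_mem_nhdsWithin).exists
    exact ⟨x, hx, s, by rw [← hdU]; exact_mod_cast hs3, hs2.le, hs1.le⟩
  choose x hxU s hds hsr hhs using hxs
  have hUV : ∀ i, U i ⊆ Metric.ball (x i) (s i) := by
    intro i y hy
    have h1 : edist y (x i) < s i := (Metric.edist_le_ediam_of_mem hy (hxU i)).trans_lt (hds i)
    rw [edist_nndist, ENNReal.coe_lt_coe] at h1
    rw [Metric.mem_ball, dist_nndist]
    exact_mod_cast h1
  obtain ⟨n, hn⟩ := exists_subset_nhds_of_isCompact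
    (directed_of_isDirected_le fun i j hij => hFa hij) hFc
    (U := ⋃ i, Metric.ball (x i) (s i)) fun y hy =>
      (isOpen_iUnion fun i => Metric.isOpen_ball).mem_nhds (iUnion_mono hUV (hUc hy))
  -- The gauge is not assumed doubling, so a ball of radius `s i` is split into two intervals.
  have hball : ∀ i, μ n (Metric.ball (x i) (s i)) ≤
      2 * C * (h (Metric.ediam (U i)).toNNReal + e i) := by
    intro i
    have hsub : Metric.ball (x i) (s i) ⊆
        Icc (x i - s i) (x i - s i + s i) ∪ Icc (x i) (x i + s i) := by
      rw [Real.ball_eq_Ioo]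
      rintro y ⟨hy1, hy2⟩
      rcases le_total y (x i) with hy | hy
      · exact Or.inl ⟨hy1.le, by linarith⟩
      · exact Or.inr ⟨hy, hy2.le⟩
    calc μ n (Metric.ball (x i) (s i)) ≤ C * h (s i) + C * h (s i) :=
          ((measure_mono hsub).trans (measure_union_le _ _)).trans
            (add_le_add (hμ n _ _ (hsr i)) (hμ n _ _ (hsr i)))
      _ = 2 * C * h (s i) := by ring
      _ ≤ _ := by gcongr; exact_mod_cast hhs i
  refine lt_irrefl c ?_
  calc c ≤ μ n (F n) := hF n
    _ ≤ ∑' i, μ n (Metric.ball (x i) (s i)) := (measure_mono hn).trans (measure_iUnion_le _)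
    _ ≤ ∑' i, 2 * C * ((h (Metric.ediam (U i)).toNNReal : ℝ≥0∞) + e i) :=
        ENNReal.tsum_le_tsum hball
    _ = 2 * C * (∑' i, (h (Metric.ediam (U i)).toNNReal : ℝ≥0∞) + ∑' i, (e i : ℝ≥0∞)) := by
        rw [ENNReal.tsum_mul_left, ENNReal.tsum_add]
    _ ≤ 2 * C * (ε + ε) := by gcongr
    _ < c := hεc

/-! ### The limit set -/

/-- The points of `[1, 2]` with `1 / 2 ≤ sin (l k * log x)` for all `k < n`. -/
def approxSet (l : ℕ → ℝ) (n : ℕ) : Set ℝ :=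
  {x ∈ Icc (1 : ℝ) 2 | ∀ k < n, 1 / 2 ≤ Real.sin (l k * Real.log x)}

theorem approxSet_antitone (l : ℕ → ℝ) : Antitone (approxSet l) :=
  fun _ _ hmn _ hx => ⟨hx.1, fun k hk => hx.2 k (hk.trans_le hmn)⟩

theorem isCompact_approxSet (l : ℕ → ℝ) (n : ℕ) : IsCompact (approxSet l n) := by
  induction n with
  | zero =>
    convert isCompact_Icc (a := (1 : ℝ)) (b := 2) using 1
    ext x
    simp [approxSet]
  | succ n ih =>
    have hcont : ContinuousOn (fun x => Real.sin (l n * Real.log x)) (approxSet l n) :=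
      Real.continuous_sin.comp_continuousOn (continuousOn_const.mul
        (Real.continuousOn_log.mono fun x hx => (one_pos.trans_le hx.1.1).ne'))
    have hclosed := hcont.preimage_isClosed_of_isClosed ih.isClosed (isClosed_Ici (a := 1 / 2))
    convert ih.of_isClosed_subset hclosed inter_subset_left using 1
    ext x
    simp only [approxSet, mem_ofPred_eq, mem_inter_iff, mem_preimage, mem_Ici,
      Nat.lt_succ_iff_lt_or_eq, or_imp, forall_and, forall_eq, and_assoc]

/-- A gauge dominating the identity eventually dominates each of its multiples. -/
theorem exists_scale_of_prec {h : ℝ≥0 → ℝ≥0} (hh : IsDimensionFunction h)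
    (hprec : Prec h fun x => x) (C : ℝ) :
    ∃ r : ℝ≥0, 0 < r ∧ ∀ t ≤ r, C * t ≤ h t := by
  have hC : (0 : ℝ≥0) < (C.toNNReal + 1)⁻¹ := by positivity
  obtain ⟨b, hb, hsub⟩ := mem_nhdsGT_iff_exists_Ioc_subset.1 (hprec.eventually (gt_mem_nhds hC))
  refine ⟨b, hb, fun t ht => ?_⟩
  rcases eq_or_lt_of_le (zero_le (a := t)) with rfl | ht0
  · simp
  · have h1 : t / h t < (C.toNNReal + 1)⁻¹ := hsub ⟨ht0, ht⟩
    rw [div_lt_iff₀ (hh.pos t ht0), inv_mul_eq_div, lt_div_iff₀ (by positivity), mul_comm] at h1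
    have h2 : ((C.toNNReal : ℝ) + 1) * t < h t := by exact_mod_cast h1
    have h3 := Real.le_coe_toNNReal C
    have h4 : (0 : ℝ) ≤ t := t.2
    nlinarith

end GaugeQuotients

open GaugeQuotients in
theorem mainTheorem2 (h : ℝ≥0 → ℝ≥0) (hh : GaugeQuotients.IsDimensionFunction h)
    (hprec : GaugeQuotients.Prec h (fun x => x))
    (A : Set ℝ) (hA : A.Countable) (hA1 : A ⊆ {1}ᶜ) :
    ∃ E : Set ℝ, IsCompact E ∧ E ⊆ Icc 1 2 ∧ 0 < GaugeQuotients.hausdorffGauge h E ∧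
      ∀ a ∈ A, a ∉ E / E := by
  obtain ⟨g, M, hg⟩ := exists_isWeight
  choose r hr0 hr using fun n : ℕ => exists_scale_of_prec hh hprec (M ^ n)
  -- The number `2` is adjoined only to make the countable set nonempty.
  obtain ⟨a, ha⟩ := (hA.insert 2).exists_eq_range (insert_nonempty _ _)
  have ha1 : ∀ n, a n ≠ 1 := by
    intro n hn
    have h1 : a n ∈ insert 2 A := ha ▸ mem_range_self n
    rcases h1 with h1 | h1
    · linarith
    · exact hA1 h1 hn
  obtain ⟨l, hl⟩ := exists_seq_density hg
    (fun n f l => (∀ x y, 0 < x → 0 < y → y = a n * x →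
      1 / 2 ≤ Real.sin (l * Real.log x) → Real.sin (l * Real.log y) < 1 / 2) ∧
      ∀ t ∈ Icc (1 : ℝ) 2, |∫ x in (1 : ℝ)..t, f x * (g (l * Real.log x) - 1)| ≤
        (1 / 2) ^ (n + 2) * min 1 (h (r (n + 1)))) fun n f hf => by
      obtain ⟨C, hC⟩ := exists_bound_integral_oscillation hg hf
      set η : ℝ := (1 / 2) ^ (n + 2) * min 1 (h (r (n + 1)))
      have hη : 0 < η := by
        have : (0 : ℝ) < h (r (n + 1)) := hh.pos _ (hr0 _)
        exact mul_pos (by positivity) (lt_min one_pos this)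
      obtain ⟨l, hl1, hl2⟩ := exists_frequency (ha1 n) (max 1 (C / η))
      have hl0 : 0 < l := one_pos.trans_le ((le_max_left _ _).trans hl1)
      refine ⟨l, hl2, fun t ht => (hC l hl0 t ht).trans ?_⟩
      rw [div_le_comm₀ hl0 hη]
      exact (le_max_right _ _).trans hl1
  have hcompact := isCompact_approxSet l
  refine ⟨⋂ n, approxSet l n, ?_, ?_, ?_, ?_⟩
  · exact (hcompact 0).of_isClosed_subset (isClosed_iInter fun n => (hcompact n).isClosed)
      (iInter_subset _ 0)
  · exact fun x hx => (mem_iInter.1 hx 0).1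
  · let μ : ℕ → Measure ℝ := fun n =>
      (volume.restrict (Icc 1 2)).withDensity fun x => ENNReal.ofReal (density g l n x)
    have hint : ∀ n, ∀ u v : ℝ, 1 ≤ u → u ≤ v → v ≤ 2 →
        ∫⁻ x in Icc u v, ENNReal.ofReal (density g l n x) =
          ENNReal.ofReal (∫ x in u..v, density g l n x) := by
      intro n u v hu huv hv
      have hu0 : 0 < u := one_pos.trans_le hu
      rw [intervalIntegral.integral_of_le huv, ← integral_Icc_eq_integral_Ioc,
        ofReal_integral_eq_lintegral_ofReal
          ((intervalIntegrable_iff_integrableOn_Icc_of_le huv).1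
            (density_intervalIntegrable hg l n hu0 (hu0.trans_le huv)))
          (Eventually.of_forall fun x => density_nonneg hg l n x)]
    refine hausdorffGauge_iInter_pos hh (approxSet_antitone l) hcompact (μ := μ)
      (c := ENNReal.ofReal (1 / 2)) (by simp) (C := 2) (hr0 0) ?_ ?_
    · intro n
      have hmeas := (hcompact n).measurableSet
      rw [withDensity_apply _ hmeas, Measure.restrict_restrict hmeas]
      have hsupp : ∫⁻ x in approxSet l n ∩ Icc 1 2, ENNReal.ofReal (density g l n x) =
          ∫⁻ x in Icc 1 2, ENNReal.ofReal (density g l n x) := by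
        rw [← setLIntegral_indicator hmeas]
        refine setLIntegral_congr_fun measurableSet_Icc fun x hx => ?_
        refine indicator_apply_eq_self.2 fun hxn => ?_
        by_contra h0
        refine hxn ⟨hx, half_le_sin_of_density_ne_zero hg l n x fun h1 => h0 ?_⟩
        rw [h1, ENNReal.ofReal_zero]
      rw [hsupp, hint n 1 2 le_rfl one_le_two le_rfl]
      refine ENNReal.ofReal_le_ofReal (half_le_integral_density hg (fun n => ?_) n)
      exact ((hl n).2 2 ⟨one_le_two, le_rfl⟩).trans
        (mul_le_of_le_one_right (by positivity) (min_le_left _ _))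
    · intro n x s hs
      rw [withDensity_apply _ measurableSet_Icc, Measure.restrict_restrict measurableSet_Icc,
        Icc_inter_Icc]
      rcases lt_or_ge (min (x + s) 2) (max x 1) with hlt | hle
      · simp [Icc_eq_empty_of_lt hlt]
      · have hlen : min (x + s) 2 - max x 1 ≤ s := by
          linarith [min_le_left (x + s) 2, le_max_left x 1]
        rw [hint n _ _ (le_max_right _ _) hle (min_le_right _ _)]
        have hmass := integral_le_two_mul_gauge hg hh hr (fun n t ht =>
          ((hl n).2 t ht).trans (mul_le_mul_of_nonneg_left (min_le_right _ _) (by positivity)))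
          n (le_max_right x 1) hle (min_le_right _ _) (hlen.trans (by exact_mod_cast hs))
        have hmono : h (min (x + s) 2 - max x 1).toNNReal ≤ h s :=
          hh.mono (Real.toNNReal_le_iff_le_coe.2 hlen)
        refine (ENNReal.ofReal_le_ofReal (hmass.trans
          (mul_le_mul_of_nonneg_left (NNReal.coe_le_coe.2 hmono) zero_le_two))).trans ?_
        rw [ENNReal.ofReal_mul zero_le_two, ENNReal.ofReal_coe_nnreal]
        simp
  · rintro b hb ⟨y, hy, x, hx, hxy⟩
    obtain ⟨n, rfl⟩ : b ∈ range a := ha ▸ mem_insert_of_mem _ hb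
    have hx' := mem_iInter.1 hx (n + 1)
    have hy' := mem_iInter.1 hy (n + 1)
    have hx0 : 0 < x := one_pos.trans_le hx'.1.1
    have hy0 : 0 < y := one_pos.trans_le hy'.1.1
    have hyx : y = a n * x := by rw [← hxy]; exact (div_mul_cancel₀ y hx0.ne').symm
    exact absurd (hy'.2 n n.lt_succ_self)
      (not_le.2 ((hl n).1 x y hx0 hy0 hyx (hx'.2 n n.lt_succ_self)))
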